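/- Let $(R,\mathfrak m)$ be a one-dimensional Noetherian local domain with infinite residue field $k$ and quotient field $K$. Assume that the integral closure $\overline R$ of $R$ in $K$ is a finite $R$-module and a discrete valuation ring, and that $R$ is residually rational, i.e. the canonical map from $k$ to the residue field of $\overline R$ is an isomorphism. Assume that $R$ is Gorenstein (i.e. of finite injective dimension over itself). Write $H(n)=\ell_R(\mathfrak m^n/\mathfrak m^{n+1})$, let $h(z)\in\mathbb Z[z]$ be the polynomial with $\sum_{n\ge 0}H(n)z^n=h(z)/(1-z)$, and let $e=h(1)$ be the multiplicity and $\mu=\ell_R(\mathfrak m/\mathfrak m^2)$ the embedding dimension of $R$. Call $x\in\mathfrak m$ a minimal reduction of $\mathfrak m$ if $\mathfrak m^{n+1}=x\mathfrak m^n$ for all $n\gg0$, and let $\nu$ be the least integer such that $\mathfrak m^{n+1}=x\mathfrak m^n$ for all $n\ge\nu$. For $R$-submodules $A,B$ of $K$ put $A:B=\{y\in K\mid yB\subseteq A\}$, and let $\Lambda=\bigcup_{n\ge 0}(\mathfrak m^n:\mathfrak m^n)\subseteq K$ be the blowing-up of $R$ along $\mathfrak m$. Then minimal reductions of $\mathfrak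 m$ exist, and for every minimal reduction $x$ of $\mathfrak m$ the following conditions are equivalent: (1) $e=\mu+1$; (2) $\nu=2$; (3) $R:\Lambda=\mathfrak m^2$. -/

import Mathlib

noncomputable section

namespace BlowUp

open IsLocalRing

/-- A commutative ring has finite injective dimension as a module over itself. For Noetherian local
rings this is the definition of a Gorenstein ring. -/
def IsGorensteinLocal (R : Type*) [CommRing R] : Prop :=
  ∃ n : ℕ, CategoryTheory.HasInjectiveDimensionLE (ModuleCat.of R R) n

/-- `R` is residually rational: the canonical map from `R` to the residue field of its
integral closure in `K` is onto, i.e. the two residue fields coincide. -/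
def IsResiduallyRational (R K : Type*) [CommRing R] [Field K] [Algebra R K]
    [IsLocalRing (integralClosure R K)] : Prop :=
  Function.Surjective
    ((residue (integralClosure R K)).comp (algebraMap R (integralClosure R K)))

section Ideals

variable {R : Type*} [CommRing R]

/-- The Hilbert function `n ↦ ℓ_R(I ^ n / I ^ (n + 1))`. -/
def hilbertFunction (I : Ideal R) (n : ℕ) : ℕ :=
  (Module.length R (↥(I ^ n) ⧸ (I ^ (n + 1)).submoduleOf (I ^ n))).toNat

/-- The Hilbert-Poincaré series `∑ H_I(n) z ^ n`. -/
def hilbertSeries (I : Ideal R) : PowerSeries ℤ :=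
  PowerSeries.mk fun n => (hilbertFunction I n : ℤ)

/-- `h` is the h-polynomial of `I`: the Hilbert-Poincaré series is `h / (1 - z)`. -/
def IsHPolynomial (I : Ideal R) (h : Polynomial ℤ) : Prop :=
  (h : PowerSeries ℤ) = (1 - PowerSeries.X) * hilbertSeries I

open Classical in
/-- The h-polynomial of `I` (unique when it exists, and `0` otherwise). -/
def hPolynomial (I : Ideal R) : Polynomial ℤ :=
  if H : ∃ h, IsHPolynomial I h then H.choose else 0

/-- The multiplicity `e(I) = h_I(1)`. -/
def multiplicity (I : Ideal R) : ℤ := (hPolynomial I).eval 1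

/-- `x ∈ I` is a minimal reduction of `I`: `I ^ (n + 1) = x I ^ n` for all large `n`. -/
def IsMinimalReduction (I : Ideal R) (x : R) : Prop :=
  x ∈ I ∧ ∃ N : ℕ, ∀ n ≥ N, I ^ (n + 1) = Ideal.span {x} * I ^ n

/-- The least `N` such that `I ^ (n + 1) = x I ^ n` for all `n ≥ N`
(the reduction exponent of `I` when `x` is a minimal reduction of `I`). -/
def reductionExponent (I : Ideal R) (x : R) : ℕ :=
  sInf {N : ℕ | ∀ n ≥ N, I ^ (n + 1) = Ideal.span {x} * I ^ n}

variable (K : Type*) [Field K] [Algebra R K]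

/-- The blowing-up `⋃ n, I ^ n : I ^ n` inside `K`. Here `A / B` is the colon
`{x ∈ K | x B ⊆ A}`; the family is increasing, so the supremum is the union
(see `mem_blowup`). -/
def blowup (I : Ideal R) : Submodule R K :=
  ⨆ n : ℕ, IsLocalization.coeSubmodule K I ^ n / IsLocalization.coeSubmodule K I ^ n

theorem mem_blowup (I : Ideal R) (y : K) :
    y ∈ blowup K I ↔ ∃ n : ℕ, ∀ z ∈ IsLocalization.coeSubmodule K I ^ n,
      y * z ∈ IsLocalization.coeSubmodule K I ^ n := by
  have hmono : Monotone fun n : ℕ =>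
      IsLocalization.coeSubmodule K I ^ n / IsLocalization.coeSubmodule K I ^ n := by
    refine monotone_nat_of_le_succ fun n => ?_
    rw [Submodule.le_div_iff_mul_le, pow_succ, ← mul_assoc]
    exact mul_le_mul' (Submodule.le_div_iff_mul_le.mp le_rfl) le_rfl
  rw [blowup, Submodule.mem_iSup_of_directed _ hmono.directed_le]
  simp only [Submodule.mem_div_iff_forall_mul_mem]

end Ideals

/-- The embedding dimension `μ = ℓ_R(𝔪 / 𝔪 ^ 2)`. -/
def embeddingDim (R : Type*) [CommRing R] [IsLocalRing R] : ℕ :=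
  hilbertFunction (maximalIdeal R) 1

end BlowUp

end

/-!
Since `R` is Gorenstein, the socle `((x) : 𝔪) / (x)` of `R / (x)` is a simple module. Because
`e = ℓ(R / (x))` and `(x) ∩ 𝔪² = x𝔪`, condition (1) says that `𝔪² / x𝔪` is simple, which by
Nakayama's lemma and the simplicity of the socle means `𝔪³ ⊆ (x)` and `𝔪² ⊄ (x)`. In that case
`(x) : 𝔪 = (x) + 𝔪²` is a minimal overideal of `𝔪²`, so that `𝔪²` is the only ideal between `𝔪²` and
`(x) : 𝔪` that does not contain `x`. Once `𝔪⁴ ⊆ (x²)` is known, this identifies `x⁻¹𝔪³` with `𝔪²`,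
which is (2), and the conductor `R : Λ = (x²) : 𝔪²` with `𝔪²`, which is (3).
-/

namespace BlowUp

open IsLocalRing

section Gorenstein

open CategoryTheory CategoryTheory.Abelian
open scoped Pointwise

universe u

variable {R : Type u} [CommRing R]

theorem subsingleton_ext_of_isFiniteLength {Y : ModuleCat.{u} R} {i : ℕ}
    (h : ∀ (S : Type u) [AddCommGroup S] [Module R S] [IsSimpleModule R S],
      Subsingleton (Ext (ModuleCat.of R S) Y i))
    {M : Type u} [AddCommGroup M] [Module R M] (hM : IsFiniteLength R M) :
    Subsingleton (Ext (ModuleCat.of R M) Y i) := by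
  refine subsingleton_of_forall_eq 0 fun e => ?_
  induction hM with
  | @of_subsingleton M _ _ _ =>
    have hid := (ModuleCat.isZero_of_subsingleton (ModuleCat.of R M)).eq_of_src (𝟙 _) 0
    rw [← Ext.mk₀_id_comp e, hid, Ext.mk₀_zero, Ext.zero_comp]
  | @of_simple_quotient M _ _ N _ _ ih =>
    obtain ⟨y, rfl⟩ := Ext.contravariant_sequence_exact₂
      (ModuleCat.shortComplex_shortExact
        (ModuleCat.shortComplexOfCompEqZero N.subtype N.mkQ (by ext; simp))
        (LinearMap.exact_subtype_mkQ N) N.subtype_injective N.mkQ_surjective) Y e (ih _)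
    rw [(h (M ⧸ N)).elim y 0, Ext.comp_zero]

theorem hasProjectiveDimensionLT_quotSMulTop {x : R} (hx : IsSMulRegular R x) :
    HasProjectiveDimensionLT (ModuleCat.of R (QuotSMulTop x R)) 2 :=
  (IsSMulRegular.smulShortComplex_shortExact (M := ModuleCat.of R R) hx).hasProjectiveDimensionLT_X₃
    1 (inferInstanceAs (HasProjectiveDimensionLT (ModuleCat.of R R) 1))
    (inferInstanceAs (HasProjectiveDimensionLT (ModuleCat.of R R) 2))

theorem exists_injective_of_isSimpleModule [IsLocalRing R] (S N : Type*)
    [AddCommGroup S] [Module R S] [IsSimpleModule R S]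
    [AddCommGroup N] [Module R N] [IsArtinian R N] [Nontrivial N] :
    ∃ f : S →ₗ[R] N, Function.Injective f := by
  obtain ⟨A, hA⟩ := IsAtomic.exists_atom (Submodule R N)
  have hA' : IsSimpleModule R A := isSimpleModule_iff_isAtom.mpr hA
  obtain ⟨I, hI, ⟨φ⟩⟩ := isSimpleModule_iff_quot_maximal.mp ‹IsSimpleModule R S›
  obtain ⟨J, hJ, ⟨ψ⟩⟩ := isSimpleModule_iff_quot_maximal.mp hA'
  obtain rfl := eq_maximalIdeal hI
  obtain rfl := eq_maximalIdeal hJ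
  exact ⟨A.subtype ∘ₗ (φ.trans ψ.symm).toLinearMap,
    A.subtype_injective.comp (φ.trans ψ.symm).injective⟩

theorem IsGorensteinLocal.subsingleton_ext [IsLocalRing R] (hR : IsGorensteinLocal R)
    {N : Type u} [AddCommGroup N] [Module R N] [Nontrivial N] (hN : IsFiniteLength R N) {d : ℕ}
    [HasProjectiveDimensionLT (ModuleCat.of R N) d]
    {M : Type u} [AddCommGroup M] [Module R M] (hM : IsFiniteLength R M) {i : ℕ} (hi : d ≤ i) :
    Subsingleton (Ext (ModuleCat.of R M) (ModuleCat.of R R) i) := by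
  obtain ⟨n, hn⟩ := hR
  have : IsArtinian R N := (isFiniteLength_iff_isNoetherian_isArtinian.mp hN).2
  induction h : n + 1 - i generalizing i M with
  | zero => exact HasInjectiveDimensionLT.subsingleton _ (n + 1) i (by omega) _
  | succ k ih =>
    -- A simple module embeds into `N`, so its `Ext i` lies between `Ext i` of `N`, which vanishes,
    -- and `Ext (i + 1)` of a module of finite length.
    refine subsingleton_ext_of_isFiniteLength (fun S _ _ _ => ?_) hM
    obtain ⟨f, hf⟩ := exists_injective_of_isSimpleModule (R := R) S N
    have hcoker : IsFiniteLength R (N ⧸ LinearMap.range f) :=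
      hN.of_surjective (Submodule.mkQ_surjective _)
    refine subsingleton_of_forall_eq 0 fun e => ?_
    obtain ⟨y, rfl⟩ := Ext.contravariant_sequence_exact₁
      (ModuleCat.shortComplex_shortExact
        (ModuleCat.shortComplexOfCompEqZero f (LinearMap.range f).mkQ (LinearMap.range_mkQ_comp f))
        (LinearMap.exact_map_mkQ_range f) hf (Submodule.mkQ_surjective _))
      _ e (add_comm 1 i) ((ih hcoker (by omega) (by omega)).elim _ _)
    rw [(HasProjectiveDimensionLT.subsingleton (ModuleCat.of R N) d i hi _).elim y 0,
      Ext.comp_zero]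

/-- Rees's isomorphism `Hom(N, M / xM) ≃ Ext¹(N, M)`. -/
theorem bijective_mk₀_comp_extClass_smulShortComplex {M N : ModuleCat.{u} R} {x : R}
    (hx : IsSMulRegular M x) (hN : ∀ b : N, x • b = 0) :
    Function.Bijective fun g : N ⟶ (M.smulShortComplex x).X₃ =>
      (Ext.mk₀ g).comp hx.smulShortComplex_shortExact.extClass (zero_add 1) := by
  have hS := hx.smulShortComplex_shortExact
  constructor
  · intro g g' hgg'
    dsimp only at hgg'
    have hcomp : (Ext.mk₀ (g - g')).comp hS.extClass (zero_add 1) = 0 := by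
      rw [sub_eq_add_neg, Ext.mk₀_add, Ext.add_comp, Ext.mk₀_neg, Ext.neg_comp, hgg',
        add_neg_cancel]
    obtain ⟨q, hq⟩ := Ext.covariant_sequence_exact₃ _ hS _ _ hcomp
    obtain ⟨q, rfl⟩ := Ext.homEquiv₀.symm.surjective q
    have hq0 : q = 0 := by
      ext b
      refine hx ?_
      change x • q.hom b = x • 0
      rw [← map_smul, hN, map_zero, smul_zero]
    rw [hq0, Ext.homEquiv₀_symm_apply, Ext.mk₀_zero, Ext.zero_comp] at hq
    exact sub_eq_zero.mp (Ext.homEquiv₀.symm.injective (by simpa using hq.symm))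
  · intro ξ
    have hxN : x • 𝟙 N = 0 := by
      ext b
      exact hN b
    have hxξ : x • ξ = 0 := by
      rw [← Ext.mk₀_id_comp ξ, ← Ext.smul_comp, ← Ext.mk₀_smul, hxN, Ext.mk₀_zero, Ext.zero_comp]
    obtain ⟨ζ, hζ⟩ := Ext.covariant_sequence_exact₁ _ hS ξ
      ((Ext.smul_eq_comp_mk₀ ξ x).symm.trans hxξ) (zero_add 1)
    obtain ⟨h, rfl⟩ := Ext.homEquiv₀.symm.surjective ζ
    exact ⟨h, hζ⟩

theorem exists_comp_eq_of_subsingleton_ext_two {M : ModuleCat.{u} R} {x : R}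
    (hx : IsSMulRegular M x) {S : ShortComplex (ModuleCat.{u} R)} (hS : S.ShortExact)
    (hxS : ∀ b : S.X₂, x • b = 0) (hExt : Subsingleton (Ext S.X₃ M 2))
    (g : S.X₁ ⟶ (M.smulShortComplex x).X₃) : ∃ h, S.f ≫ h = g := by
  have hxS₁ : ∀ a : S.X₁, x • a = 0 := fun a =>
    (ModuleCat.mono_iff_injective S.f).mp hS.mono_f (by rw [map_smul, hxS, map_zero])
  obtain ⟨ξ, hξ⟩ := Ext.contravariant_sequence_exact₁ hS _
    ((Ext.mk₀ g).comp hx.smulShortComplex_shortExact.extClass (zero_add 1)) rfl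
    (hExt.elim _ _)
  obtain ⟨h, rfl⟩ := (bijective_mk₀_comp_extClass_smulShortComplex hx hxS).surjective ξ
  refine ⟨h, (bijective_mk₀_comp_extClass_smulShortComplex hx hxS₁).injective ?_⟩
  dsimp only at hξ ⊢
  rw [← hξ, ← Ext.mk₀_comp_mk₀, Ext.comp_assoc_of_second_deg_zero]

variable [IsLocalRing R] {x : R}

theorem IsGorensteinLocal.mem_span_singleton_of_forall_smul_eq_zero (hR : IsGorensteinLocal R)
    (hx : IsSMulRegular R x) (hfin : IsFiniteLength R (QuotSMulTop x R)) {s t : QuotSMulTop x R}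
    (hst : ∀ a : R, a • s = 0 → a • t = 0) : t ∈ Submodule.span R {s} := by
  rcases subsingleton_or_nontrivial (QuotSMulTop x R) with _ | _
  · exact Subsingleton.elim s t ▸ Submodule.mem_span_singleton_self s
  have := hasProjectiveDimensionLT_quotSMulTop hx
  -- The map `a • s ↦ a • t` extends to an endomorphism of the cyclic module `R / xR`.
  let f : (R ⧸ Ideal.torsionOf R _ s) →ₗ[R] QuotSMulTop x R :=
    Submodule.liftQ _ (LinearMap.toSpanSingleton R _ s) le_rfl
  let g : (R ⧸ Ideal.torsionOf R _ s) →ₗ[R] QuotSMulTop x R :=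
    Submodule.liftQ _ (LinearMap.toSpanSingleton R _ t) hst
  have hf : Function.Injective f :=
    LinearMap.ker_eq_bot.mp (Submodule.ker_liftQ_eq_bot _ _ _ le_rfl)
  obtain ⟨h, hfg⟩ := exists_comp_eq_of_subsingleton_ext_two (M := ModuleCat.of R R) hx
    (ModuleCat.shortComplex_shortExact
      (ModuleCat.shortComplexOfCompEqZero f (LinearMap.range f).mkQ (LinearMap.range_mkQ_comp f))
      (LinearMap.exact_map_mkQ_range f) hf (Submodule.mkQ_surjective _))
    (Module.mem_annihilator.mp (QuotSMulTop.mem_annihilator R x))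
    (hR.subsingleton_ext hfin (hfin.of_surjective (Submodule.mkQ_surjective _)) le_rfl)
    (ModuleCat.ofHom g)
  let h' : QuotSMulTop x R →ₗ[R] QuotSMulTop x R := h.hom
  have hst' : h' s = t := by
    have hone : h' ((1 : R) • s) = (1 : R) • t :=
      LinearMap.congr_fun (congrArg ModuleCat.Hom.hom hfg) (Submodule.Quotient.mk 1)
    rwa [one_smul, one_smul] at hone
  obtain ⟨a, ha⟩ := Submodule.Quotient.mk_surjective _ s
  obtain ⟨b, hb⟩ := Submodule.Quotient.mk_surjective _ (h' (Submodule.Quotient.mk 1))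
  have hsmul : ∀ c : R, (Submodule.Quotient.mk c : QuotSMulTop x R) = c • Submodule.Quotient.mk 1 :=
    fun c => by rw [← Submodule.Quotient.mk_smul, smul_eq_mul, mul_one]
  refine Submodule.mem_span_singleton.mpr ⟨b, ?_⟩
  rw [← hst', ← ha, hsmul a, map_smul, ← hb, hsmul b, smul_comm]

theorem lt_colon_maximalIdeal {I : Ideal R} (hI : I ≠ ⊤) [IsArtinian R (R ⧸ I)] :
    I < I.colon (maximalIdeal R : Set R) := by
  have : Nontrivial (R ⧸ I) := Submodule.Quotient.nontrivial_iff.mpr hI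
  have : IsSimpleModule R (R ⧸ maximalIdeal R) :=
    isSimpleModule_iff_isCoatom.mpr (maximalIdeal.isMaximal R).out
  obtain ⟨f, hf⟩ := exists_injective_of_isSimpleModule (R := R) (R ⧸ maximalIdeal R) (R ⧸ I)
  obtain ⟨s, hs⟩ := Submodule.Quotient.mk_surjective _ (f 1)
  have hmk : ∀ a : R, (Submodule.Quotient.mk (a * s) : R ⧸ I) = f (Submodule.Quotient.mk a) := by
    intro a
    rw [← smul_eq_mul, Submodule.Quotient.mk_smul, hs, ← map_smul, Algebra.smul_def, mul_one]
    rfl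
  refine lt_of_le_not_ge Ideal.le_colon fun hle => ?_
  have hsI : s ∈ I := hle <| Submodule.mem_colon.mpr fun a ha => by
    rw [smul_eq_mul, mul_comm, ← Submodule.Quotient.mk_eq_zero, hmk,
      (Submodule.Quotient.mk_eq_zero _).mpr ha, map_zero]
  rw [← Submodule.Quotient.mk_eq_zero, hs] at hsI
  exact one_ne_zero (hf (hsI.trans (map_zero f).symm))

theorem IsGorensteinLocal.covBy_colon (hR : IsGorensteinLocal R)
    (hx : IsSMulRegular R x) (hxm : x ∈ maximalIdeal R)
    (hfin : IsFiniteLength R (R ⧸ Ideal.span {x})) :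
    Ideal.span {x} ⋖ (Ideal.span {x}).colon (maximalIdeal R : Set R) := by
  have : IsArtinian R (R ⧸ Ideal.span {x}) :=
    (isFiniteLength_iff_isNoetherian_isArtinian.mp hfin).2
  refine ⟨lt_colon_maximalIdeal (by simpa [Ideal.span_singleton_eq_top] using hxm),
    fun J hlt hJ => ?_⟩
  have hspan : Ideal.span {x} = x • (⊤ : Submodule R R) := by
    rw [← Submodule.ideal_span_singleton_smul, smul_eq_mul, Ideal.mul_top]
  rw [hspan] at hfin hlt hJ
  obtain ⟨s, hsJ, hs⟩ := SetLike.exists_of_lt hlt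
  refine hJ.not_ge fun t ht => ?_
  have hst : ∀ a : R, a • (Submodule.Quotient.mk s : QuotSMulTop x R) = 0 →
      a • (Submodule.Quotient.mk t : QuotSMulTop x R) = 0 := by
    intro a has
    rw [← Submodule.Quotient.mk_smul, Submodule.Quotient.mk_eq_zero] at has ⊢
    by_cases ha : a ∈ maximalIdeal R
    · rw [smul_eq_mul, mul_comm]
      exact Submodule.mem_colon.mp ht a ha
    · exact absurd ((Ideal.unit_mul_mem_iff_mem _ (notMem_maximalIdeal.mp ha)).mp has) hs
  obtain ⟨b, hb⟩ := Submodule.mem_span_singleton.mp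
    (hR.mem_span_singleton_of_forall_smul_eq_zero hx hfin hst)
  rw [← Submodule.Quotient.mk_smul, Submodule.Quotient.eq] at hb
  exact (Submodule.sub_mem_iff_right J (J.smul_mem b hsJ)).mp (hlt.le hb)

end Gorenstein

section Length

open scoped Pointwise

variable {R : Type*} [CommRing R]

/-- The colength `ℓ_R(R / I)`, with the value `0` when it is infinite. -/
noncomputable def colength (I : Ideal R) : ℕ := (Module.length R (R ⧸ I)).toNat

theorem length_quotient_eq_add {I J : Ideal R} (h : J ≤ I) :
    Module.length R (R ⧸ J) =
      Module.length R (I ⧸ J.submoduleOf I) + Module.length R (R ⧸ I) := by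
  change _ = Module.length R (I ⧸ Submodule.comap I.subtype J) + _
  refine Module.length_eq_add_of_exact (Submodule.mapQ _ J I.subtype le_rfl)
    (Submodule.factor h) ?_ (Submodule.factor_surjective h) ?_
  · rw [← LinearMap.ker_eq_bot, Submodule.ker_mapQ]
    exact Submodule.mkQ_map_self _
  · rw [LinearMap.exact_iff, Submodule.range_mapQ, Submodule.range_subtype, Submodule.factor,
      Submodule.ker_mapQ, Submodule.comap_id]

theorem length_quotient_span_singleton_mul {x : R} (hx : x ∈ nonZeroDivisors R) (I : Ideal R) :
    Module.length R (R ⧸ Ideal.span {x} * I) =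
      Module.length R (R ⧸ I) + Module.length R (R ⧸ Ideal.span {x}) := by
  rw [← smul_eq_mul (Ideal.span {x}) I, Submodule.ideal_span_singleton_smul]
  exact Module.length_eq_add_of_exact _ _ (Ideal.mulQuot_injective I hx)
    (Ideal.quotOfMul_surjective I) (Ideal.exact_mulQuot_quotOfMul I)

variable [IsDomain R] [IsNoetherianRing R] [Ring.KrullDimLE 1 R]

theorem isFiniteLength_quotient {I : Ideal R} (hI : I ≠ ⊥) : IsFiniteLength R (R ⧸ I) := by
  obtain ⟨x, hxI, hx⟩ := Submodule.exists_mem_ne_zero_of_ne_bot hI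
  exact (isFiniteLength_quotient_span_singleton R (mem_nonZeroDivisors_of_ne_zero hx)).of_surjective
    (Submodule.factor_surjective ((Ideal.span_singleton_le_iff_mem I).mpr hxI))

theorem coe_colength {I : Ideal R} (hI : I ≠ ⊥) :
    (colength I : ℕ∞) = Module.length R (R ⧸ I) :=
  ENat.natCast_toNat (Module.length_ne_top_iff.mpr (isFiniteLength_quotient hI))

theorem length_quotient_submoduleOf_add_colength {I J : Ideal R} (hJ : J ≠ ⊥) (h : J ≤ I) :
    Module.length R (I ⧸ J.submoduleOf I) + colength I = colength J := by
  rw [coe_colength hJ, coe_colength (ne_bot_of_le_ne_bot hJ h), length_quotient_eq_add h]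

theorem colength_span_singleton_mul {x : R} (hx : x ≠ 0) {I : Ideal R} (hI : I ≠ ⊥) :
    colength (Ideal.span {x} * I) = colength I + colength (Ideal.span {x}) := by
  have hx' : Ideal.span {x} ≠ ⊥ := Ideal.span_singleton_eq_bot.not.mpr hx
  apply ENat.natCast_inj.mp
  rw [Nat.cast_add, coe_colength (mul_ne_zero hx' hI), coe_colength hI, coe_colength hx',
    length_quotient_span_singleton_mul (mem_nonZeroDivisors_of_ne_zero hx)]

theorem hilbertFunction_add_colength {I : Ideal R} (hI : I ≠ ⊥) (n : ℕ) :
    hilbertFunction I n + colength (I ^ n) = colength (I ^ (n + 1)) := by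
  have h := length_quotient_submoduleOf_add_colength (pow_ne_zero (n + 1) hI)
    (Ideal.pow_le_pow_right (I := I) n.le_succ)
  have hfin : Module.length R (↥(I ^ n) ⧸ (I ^ (n + 1)).submoduleOf (I ^ n)) ≠ ⊤ := fun htop =>
    ENat.natCast_ne_top _ (by rw [← h, htop, top_add])
  rw [← ENat.natCast_toNat hfin] at h
  exact_mod_cast h

theorem covBy_iff_colength {I J : Ideal R} (hJ : J ≠ ⊥) (h : J ≤ I) :
    J ⋖ I ↔ colength J = colength I + 1 := by
  rw [covBy_iff_quot_is_simple h, ← Module.length_eq_one_iff, ← ENat.natCast_inj,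
    ← length_quotient_submoduleOf_add_colength hJ h, Nat.cast_add, add_comm (colength I : ℕ∞),
    (ENat.add_left_injective_of_ne_top (ENat.natCast_ne_top (colength I))).eq_iff, Nat.cast_one]
  rfl

theorem colength_maximalIdeal [IsLocalRing R] (hm : maximalIdeal R ≠ ⊥) :
    colength (maximalIdeal R) = 1 := by
  rw [(covBy_iff_colength hm le_top).mp (covBy_top_iff.mpr (maximalIdeal.isMaximal R).out),
    colength, Module.length_eq_zero_iff.mpr (Submodule.Quotient.subsingleton_iff.mpr rfl)]
  rfl

end Length

section Multiplicity

open PowerSeries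

variable {R : Type*} [CommRing R] {I : Ideal R}

theorem IsHPolynomial.hPolynomial_eq {h : Polynomial ℤ} (hh : IsHPolynomial I h) :
    hPolynomial I = h := by
  have hex : ∃ p, IsHPolynomial I p := ⟨h, hh⟩
  rw [hPolynomial, dif_pos hex]
  exact Polynomial.coe_injective ℤ (hex.choose_spec.trans hh.symm)

theorem isHPolynomial_of_hilbertFunction_eq {c N : ℕ} (h : ∀ n ≥ N, hilbertFunction I n = c) :
    IsHPolynomial I ((1 - Polynomial.X) * trunc N (hilbertSeries I) +
      Polynomial.C (c : ℤ) * Polynomial.X ^ N) := by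
  have htail : hilbertSeries I = (trunc N (hilbertSeries I) : PowerSeries ℤ) +
      X ^ N * (PowerSeries.C (c : ℤ) * PowerSeries.mk 1) := by
    ext n
    rw [map_add, coeff_X_pow_mul', Polynomial.coeff_coe, coeff_trunc]
    by_cases hn : n < N
    · rw [if_pos hn, if_neg (by omega), add_zero]
    · rw [if_neg hn, if_pos (by omega), zero_add, coeff_C_mul, coeff_mk, Pi.one_apply, mul_one,
        hilbertSeries, coeff_mk, h n (by omega)]
  have hgeom : (PowerSeries.mk 1 : PowerSeries ℤ) * (1 - X) = 1 := mk_one_mul_one_sub_eq_one ℤ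
  rw [IsHPolynomial]
  push_cast
  linear_combination (X - 1) * htail - PowerSeries.C (c : ℤ) * X ^ N * hgeom

theorem multiplicity_eq_of_hilbertFunction_eq {c N : ℕ} (h : ∀ n ≥ N, hilbertFunction I n = c) :
    multiplicity I = c := by
  rw [multiplicity, (isHPolynomial_of_hilbertFunction_eq h).hPolynomial_eq]
  simp

end Multiplicity

section PrincipalIdeal

variable {R : Type*} [CommRing R] {x : R}

theorem span_singleton_dvd_of_le {I : Ideal R} (h : I ≤ Ideal.span {x}) : Ideal.span {x} ∣ I := by
  refine ⟨Submodule.comap (LinearMap.mulLeft R x) I,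
    (Ideal.eq_span_singleton_mul _ _).mpr ⟨fun z hz => ?_, fun z hz => hz⟩⟩
  obtain ⟨y, rfl⟩ := Ideal.mem_span_singleton.mp (h hz)
  exact ⟨y, hz, rfl⟩

theorem span_singleton_mul_covBy [IsDomain R] (hx : x ≠ 0) {I J : Ideal R} (h : J ⋖ I) :
    Ideal.span {x} * J ⋖ Ideal.span {x} * I := by
  have hlt {A B : Ideal R} : Ideal.span {x} * A < Ideal.span {x} * B ↔ A < B := by
    simp only [lt_iff_le_not_ge, Ideal.span_singleton_mul_right_mono hx]
  refine ⟨hlt.mpr h.lt, fun A hJA hAI => ?_⟩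
  obtain ⟨A, rfl⟩ := span_singleton_dvd_of_le (hAI.le.trans Ideal.mul_le_left)
  exact h.2 (hlt.mp hJA) (hlt.mp hAI)

end PrincipalIdeal

section MinimalReduction

variable {R : Type*} [CommRing R] {I : Ideal R} {x : R}

theorem pow_succ_eq_of_eq {N : ℕ} (h : I ^ (N + 1) = Ideal.span {x} * I ^ N) :
    ∀ n ≥ N, I ^ (n + 1) = Ideal.span {x} * I ^ n := by
  intro n hn
  induction n, hn using Nat.le_induction with
  | base => exact h
  | succ n _ ih => rw [pow_succ, ih, mul_assoc, ← pow_succ, ih]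

theorem pow_add_eq_of_eq {N : ℕ} (h : I ^ (N + 1) = Ideal.span {x} * I ^ N) (k : ℕ) :
    I ^ (N + k) = Ideal.span {x} ^ k * I ^ N := by
  induction k with
  | zero => simp only [add_zero, pow_zero, one_mul]
  | succ k ih =>
    rw [← add_assoc, pow_succ_eq_of_eq h _ (Nat.le_add_right N k), ih, ← mul_assoc, ← pow_succ']

namespace IsMinimalReduction

theorem span_singleton_le (hx : IsMinimalReduction I x) : Ideal.span {x} ≤ I :=
  (Ideal.span_singleton_le_iff_mem I).mpr hx.1

theorem span_singleton_mul_pow_le (hx : IsMinimalReduction I x) (n : ℕ) :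
    Ideal.span {x} * I ^ n ≤ I ^ (n + 1) :=
  (pow_succ' I n).symm ▸ Ideal.mul_mono_left hx.span_singleton_le

theorem reductionExponent_le_iff (hx : IsMinimalReduction I x) {n : ℕ} :
    reductionExponent I x ≤ n ↔ I ^ (n + 1) = Ideal.span {x} * I ^ n :=
  ⟨fun h => Nat.sInf_mem hx.2 n h, fun h => Nat.sInf_le (pow_succ_eq_of_eq h)⟩

theorem ne_zero [IsDomain R] (hx : IsMinimalReduction I x) (hI : I ≠ ⊥) : x ≠ 0 := by
  rintro rfl
  obtain ⟨-, N, hN⟩ := hx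
  have hbot : I ^ (N + 1) = ⊥ := by rw [hN N le_rfl, Ideal.span_singleton_zero, Ideal.bot_mul]
  exact pow_ne_zero (N + 1) hI hbot

variable [IsDomain R] [IsNoetherianRing R]

theorem multiplicity_eq_colength [Ring.KrullDimLE 1 R] (hx : IsMinimalReduction I x)
    (hI : I ≠ ⊥) : multiplicity I = colength (Ideal.span {x}) := by
  obtain ⟨N, hN⟩ := hx.2
  refine multiplicity_eq_of_hilbertFunction_eq (N := N) fun n hn => ?_
  have h := hilbertFunction_add_colength hI n
  rw [hN n hn, colength_span_singleton_mul (hx.ne_zero hI) (pow_ne_zero n hI)] at h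
  omega

variable [IsLocalRing R]

local notation "𝔪" => maximalIdeal R

theorem pow_notMem (hx : IsMinimalReduction I x) (hI : I ≠ ⊥) (k : ℕ) : x ^ k ∉ 𝔪 * I ^ k := by
  intro hk
  obtain ⟨-, N, hN⟩ := hx
  have hle : I ^ (N + k) ≤ 𝔪 * I ^ (N + k) :=
    calc I ^ (N + k) = Ideal.span {x ^ k} * I ^ N := by
          rw [pow_add_eq_of_eq (hN N le_rfl), Ideal.span_singleton_pow]
      _ ≤ 𝔪 * I ^ k * I ^ N := Ideal.mul_mono_left ((Ideal.span_singleton_le_iff_mem _).mpr hk)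
      _ = 𝔪 * I ^ (N + k) := by rw [mul_assoc, ← pow_add, add_comm k]
  exact pow_ne_zero (N + k) hI (Submodule.eq_bot_of_le_smul_of_le_jacobson_bot 𝔪 _
    (IsNoetherian.noetherian _) hle (maximalIdeal_le_jacobson _))

theorem inf_maximalIdeal_mul_le (hx : IsMinimalReduction I x) (hI : I ≠ ⊥) :
    Ideal.span {x} ⊓ 𝔪 * I ≤ Ideal.span {x} * 𝔪 := by
  rintro a ⟨hax, ha⟩
  obtain ⟨b, rfl⟩ := Ideal.mem_span_singleton.mp hax
  refine Ideal.mul_mem_mul (Ideal.mem_span_singleton_self x) ?_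
  by_contra hb
  refine hx.pow_notMem hI 1 ?_
  rw [pow_one, pow_one]
  exact (Ideal.mul_unit_mem_iff_mem _ (notMem_maximalIdeal.mp hb)).mp ha

theorem inf_sq_eq (hx : IsMinimalReduction 𝔪 x) (hm : 𝔪 ≠ ⊥) :
    Ideal.span {x} ⊓ 𝔪 ^ 2 = Ideal.span {x} * 𝔪 := by
  rw [pow_two]
  exact le_antisymm (hx.inf_maximalIdeal_mul_le hm)
    (le_inf Ideal.mul_le_left (Ideal.mul_mono_left hx.span_singleton_le))

theorem multiplicity_eq_embeddingDim_add_one_iff [Ring.KrullDimLE 1 R]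
    (hx : IsMinimalReduction 𝔪 x) (hm : 𝔪 ≠ ⊥) :
    multiplicity 𝔪 = (embeddingDim R : ℤ) + 1 ↔ Ideal.span {x} * 𝔪 ⋖ 𝔪 ^ 2 := by
  have hx0 := hx.ne_zero hm
  have hsq := hilbertFunction_add_colength hm 1
  rw [pow_one, colength_maximalIdeal hm] at hsq
  rw [hx.multiplicity_eq_colength hm, embeddingDim, covBy_iff_colength
    (mul_ne_zero (Ideal.span_singleton_eq_bot.not.mpr hx0) hm)
    (by simpa only [pow_one] using hx.span_singleton_mul_pow_le 1),
    colength_span_singleton_mul hx0 hm, colength_maximalIdeal hm, ← hsq]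
  omega

end IsMinimalReduction

end MinimalReduction

section Existence

theorem exists_mem_forall_algebraMap_dvd {R : Type*} (V : Type*) [CommRing R] [CommRing V]
    [IsDomain V] [IsDiscreteValuationRing V] [Algebra R V] (I : Ideal R) :
    ∃ x ∈ I, ∀ a ∈ I, algebraMap R V x ∣ algebraMap R V a := by
  obtain ⟨x, hx, hmin⟩ := exists_minimalFor_of_wellFoundedLT (· ∈ I)
    (fun a => IsDiscreteValuationRing.addVal V (algebraMap R V a)) ⟨0, I.zero_mem⟩
  exact ⟨x, hx, fun a ha =>
    IsDiscreteValuationRing.addVal_le_iff_dvd.mp ((le_total _ _).elim (hmin ha) id)⟩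

variable {R V : Type*} [CommRing R] [CommRing V] [Algebra R V] [IsNoetherian R V] {I : Ideal R}
  {x : R}

theorem exists_forall_pow_mul_mem_of_pow_succ_mul_mem (hx : x ∈ I) :
    ∃ N : ℕ, ∀ v : V, ∀ a ∈ I ^ (N + 1), algebraMap R V a = algebraMap R V x ^ (N + 1) * v →
      ∃ b ∈ I ^ N, algebraMap R V b = algebraMap R V x ^ N * v := by
  let L (n : ℕ) : Submodule R V := Submodule.comap (LinearMap.mulLeft R (algebraMap R V x ^ n))
    (Submodule.map (Algebra.linearMap R V) (I ^ n))
  have hL : Monotone L := by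
    refine monotone_nat_of_le_succ fun n v => ?_
    rintro ⟨a, ha, hav⟩
    refine ⟨x * a, pow_succ' I n ▸ Ideal.mul_mem_mul hx ha, ?_⟩
    simp only [Algebra.linearMap_apply, LinearMap.mulLeft_apply] at hav ⊢
    rw [map_mul, hav, pow_succ', mul_assoc]
  obtain ⟨N, hN⟩ := monotone_stabilizes_iff_noetherian.mpr ‹IsNoetherian R V› ⟨L, hL⟩
  refine ⟨N, fun v a ha hav => ?_⟩
  have hv : v ∈ L (N + 1) := ⟨a, ha, hav⟩
  exact (hN (N + 1) N.le_succ).ge hv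

theorem isMinimalReduction_of_forall_algebraMap_dvd [FaithfulSMul R V] (hx : x ∈ I)
    (hdvd : ∀ a ∈ I, algebraMap R V x ∣ algebraMap R V a) : IsMinimalReduction I x := by
  have hpow (n : ℕ) {a : R} (ha : a ∈ I ^ n) : algebraMap R V x ^ n ∣ algebraMap R V a := by
    have hle : I.map (algebraMap R V) ≤ Ideal.span {algebraMap R V x} :=
      Ideal.map_le_iff_le_comap.mpr fun b hb => Ideal.mem_span_singleton.mpr (hdvd b hb)
    have hle_pow := Ideal.pow_right_mono hle n
    rw [← Ideal.map_pow, Ideal.span_singleton_pow] at hle_pow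
    exact Ideal.mem_span_singleton.mp (hle_pow (Ideal.mem_map_of_mem _ ha))
  obtain ⟨N, hN⟩ := exists_forall_pow_mul_mem_of_pow_succ_mul_mem (V := V) hx
  refine ⟨hx, N, pow_succ_eq_of_eq (le_antisymm (fun a ha => ?_) ?_)⟩
  · obtain ⟨v, hv⟩ := hpow (N + 1) ha
    obtain ⟨b, hb, hbv⟩ := hN v a ha hv
    refine Ideal.mem_span_singleton_mul.mpr ⟨b, hb, FaithfulSMul.algebraMap_injective R V ?_⟩
    rw [map_mul, hbv, hv, pow_succ', mul_assoc]
  · rw [pow_succ']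
    exact Ideal.mul_mono_left ((Ideal.span_singleton_le_iff_mem I).mpr hx)

theorem exists_isMinimalReduction (V : Type*) [CommRing V] [IsDomain V]
    [IsDiscreteValuationRing V] [Algebra R V] [FaithfulSMul R V] [IsNoetherian R V] (I : Ideal R) :
    ∃ x : R, IsMinimalReduction I x := by
  obtain ⟨x, hx, hdvd⟩ := exists_mem_forall_algebraMap_dvd V I
  exact ⟨x, isMinimalReduction_of_forall_algebraMap_dvd hx hdvd⟩

end Existence

section PowerComparison

variable {R : Type*} [CommRing R] {A J X : Ideal R}

theorem mul_pow_le_pow_mul (h : A * J ≤ X * A) (n : ℕ) : A * J ^ n ≤ X ^ n * A := by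
  induction n with
  | zero => simp only [pow_zero, mul_one, one_mul, le_refl]
  | succ n ih =>
    calc A * J ^ (n + 1) = A * J ^ n * J := by ring
      _ ≤ X ^ n * A * J := Ideal.mul_mono_left ih
      _ = X ^ n * (A * J) := by ring
      _ ≤ X ^ n * (X * A) := Ideal.mul_mono_right h
      _ = X ^ (n + 1) * A := by ring

theorem pow_mul_le_pow_succ_sup_pow_succ (h : A * J ≤ X * A) (hX : X * J ≤ J ^ 2 ⊔ X ^ 2 * A)
    (n : ℕ) : X ^ n * J ≤ J ^ (n + 1) ⊔ X ^ (n + 1) := by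
  induction n with
  | zero => simp only [pow_zero, one_mul, zero_add, pow_one, le_sup_left]
  | succ n ih =>
    have hA : X ^ 2 * A * J ^ n ≤ X ^ (n + 2) :=
      calc X ^ 2 * A * J ^ n = X ^ 2 * (A * J ^ n) := mul_assoc _ _ _
        _ ≤ X ^ 2 * (X ^ n * A) := Ideal.mul_mono_right (mul_pow_le_pow_mul h n)
        _ = X ^ (n + 2) * A := by ring
        _ ≤ X ^ (n + 2) := Ideal.mul_le_left
    have hJ : X * J * J ^ n ≤ J ^ (n + 2) ⊔ X ^ (n + 2) :=
      calc X * J * J ^ n ≤ (J ^ 2 ⊔ X ^ 2 * A) * J ^ n := Ideal.mul_mono_left hX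
        _ = J ^ (n + 2) ⊔ X ^ 2 * A * J ^ n := by rw [Ideal.sup_mul, ← pow_add, add_comm 2]
        _ ≤ J ^ (n + 2) ⊔ X ^ (n + 2) := sup_le_sup_left hA _
    calc X ^ (n + 1) * J = X * (X ^ n * J) := by ring
      _ ≤ X * (J ^ (n + 1) ⊔ X ^ (n + 1)) := Ideal.mul_mono_right ih
      _ = X * J * J ^ n ⊔ X ^ (n + 2) := by
        rw [Ideal.mul_sup, ← pow_succ', pow_succ' J, ← mul_assoc]
      _ ≤ J ^ (n + 2) ⊔ X ^ (n + 2) := sup_le hJ le_sup_right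

end PowerComparison

section AlmostMinimalMultiplicity

variable {R : Type*} [CommRing R] [IsLocalRing R]

local notation "𝔪" => maximalIdeal R

theorem sup_sq_eq_colon {I : Ideal R} (hcov : I ⋖ I.colon (𝔪 : Set R)) (h3 : 𝔪 ^ 3 ≤ I)
    (h2 : ¬ 𝔪 ^ 2 ≤ I) : I ⊔ 𝔪 ^ 2 = I.colon (𝔪 : Set R) := by
  have hle : 𝔪 ^ 2 ≤ I.colon (𝔪 : Set R) := fun a ha =>
    Submodule.mem_colon.mpr fun b hb => h3 (pow_succ 𝔪 2 ▸ Ideal.mul_mem_mul ha hb)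
  exact (hcov.eq_or_eq le_sup_left (sup_le hcov.le hle)).resolve_left fun h =>
    h2 (le_sup_right.trans h.le)

variable [IsNoetherianRing R]

theorem maximalIdeal_mul_le_of_covBy {I J : Ideal R} (h : J ⋖ I) : 𝔪 * I ≤ J := by
  rcases h.eq_or_eq le_sup_right (sup_le Ideal.mul_le_right h.le : 𝔪 * I ⊔ J ≤ I) with hJ | hI
  · exact le_sup_left.trans hJ.le
  · refine absurd (Submodule.le_of_le_smul_of_le_jacobson_bot (I := 𝔪)
      (IsNoetherian.noetherian _) (maximalIdeal_le_jacobson _) ?_) h.lt.not_ge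
    rw [smul_eq_mul, sup_comm]
    exact hI.ge

theorem pow_three_le_of_mul_covBy_sq {I : Ideal R} (h : I * 𝔪 ⋖ 𝔪 ^ 2) : 𝔪 ^ 3 ≤ I * 𝔪 := by
  rw [pow_succ']
  exact maximalIdeal_mul_le_of_covBy h

namespace IsMinimalReduction

variable [IsDomain R] {x : R} (hx : IsMinimalReduction (maximalIdeal R) x) (hm : maximalIdeal R ≠ ⊥)
include hx hm

theorem sq_le_iff : 𝔪 ^ 2 ≤ Ideal.span {x} ↔ 𝔪 ^ 2 = Ideal.span {x} * 𝔪 := by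
  rw [← hx.inf_sq_eq hm, eq_comm, inf_eq_right]

theorem pow_four_le (h : Ideal.span {x} * 𝔪 ⋖ 𝔪 ^ 2) : 𝔪 ^ 4 ≤ Ideal.span {x} ^ 2 := by
  have hx0 := hx.ne_zero hm
  have h3 := pow_three_le_of_mul_covBy_sq h
  have hle : (𝔪 ^ 2) ^ 2 ≤ Ideal.span {x} * 𝔪 ^ 2 :=
    calc (𝔪 ^ 2) ^ 2 = 𝔪 ^ 3 * 𝔪 := by ring
      _ ≤ Ideal.span {x} * 𝔪 * 𝔪 := Ideal.mul_mono_left h3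
      _ = Ideal.span {x} * 𝔪 ^ 2 := by ring
  have hX := span_singleton_mul_covBy hx0 h
  rw [← mul_assoc, ← pow_two] at hX
  rcases hX.eq_or_eq le_sup_right (sup_le hle hX.le) with h4 | h4
  · exact (pow_mul 𝔪 2 2).le.trans ((le_sup_left.trans h4.le).trans Ideal.mul_le_left)
  -- Otherwise iterating `x𝔪² ⊆ 𝔪⁴ + x²𝔪` pushes `xᴺ𝔪²` into `(xᴺ⁺¹)`, so that `𝔪² ⊆ (x)`.
  obtain ⟨N, hN⟩ := hx.2
  have hpow : (𝔪 ^ 2) ^ (N + 1) ≤ Ideal.span {x} ^ (N + 1) :=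
    calc (𝔪 ^ 2) ^ (N + 1) = 𝔪 ^ (N + (N + 2)) := by ring
      _ = Ideal.span {x} ^ (N + 1) * (Ideal.span {x} * 𝔪 ^ N) := by
        rw [pow_add_eq_of_eq (hN N le_rfl)]; ring
      _ ≤ Ideal.span {x} ^ (N + 1) := Ideal.mul_le_left
  have hcancel : Ideal.span {x} ^ N * 𝔪 ^ 2 ≤ Ideal.span {x} ^ N * Ideal.span {x} := by
    rw [← pow_succ]
    exact (pow_mul_le_pow_succ_sup_pow_succ (by rwa [← pow_succ'] : 𝔪 * 𝔪 ^ 2 ≤ _) h4.ge N).trans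
      (sup_le hpow le_rfl)
  rw [Ideal.span_singleton_pow, Ideal.span_singleton_mul_right_mono (pow_ne_zero N hx0)] at hcancel
  exact absurd ((hx.sq_le_iff hm).mp hcancel) h.ne'

theorem mul_covBy_sq_iff (hcov : Ideal.span {x} ⋖ (Ideal.span {x}).colon (𝔪 : Set R)) :
    Ideal.span {x} * 𝔪 ⋖ 𝔪 ^ 2 ↔ 𝔪 ^ 3 ≤ Ideal.span {x} ∧ ¬ 𝔪 ^ 2 ≤ Ideal.span {x} := by
  refine ⟨fun h => ⟨(pow_three_le_of_mul_covBy_sq h).trans Ideal.mul_le_left, fun h2 =>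
    h.ne' ((hx.sq_le_iff hm).mp h2)⟩, fun ⟨h3, h2⟩ => ?_⟩
  rw [← hx.inf_sq_eq hm]
  rw [← sup_sq_eq_colon hcov h3 h2] at hcov
  exact inf_covBy_of_covBy_sup_left hcov

theorem sq_covBy_colon (hcov : Ideal.span {x} ⋖ (Ideal.span {x}).colon (𝔪 : Set R))
    (h : Ideal.span {x} * 𝔪 ⋖ 𝔪 ^ 2) : 𝔪 ^ 2 ⋖ (Ideal.span {x}).colon (𝔪 : Set R) := by
  obtain ⟨h3, h2⟩ := (hx.mul_covBy_sq_iff hm hcov).mp h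
  rw [← sup_sq_eq_colon hcov h3 h2]
  apply covBy_sup_of_inf_covBy_left
  have htop : 𝔪 ⋖ ⊤ := covBy_top_iff.mpr (maximalIdeal.isMaximal R).out
  simpa only [hx.inf_sq_eq hm, Ideal.mul_top] using span_singleton_mul_covBy (hx.ne_zero hm) htop

theorem eq_sq_of_le_colon (hcov : Ideal.span {x} ⋖ (Ideal.span {x}).colon (𝔪 : Set R))
    (h : Ideal.span {x} * 𝔪 ⋖ 𝔪 ^ 2) {J : Ideal R} (hJ : 𝔪 ^ 2 ≤ J)
    (hJS : J ≤ (Ideal.span {x}).colon (𝔪 : Set R)) (hxJ : x ∉ J) : J = 𝔪 ^ 2 :=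
  ((hx.sq_covBy_colon hm hcov h).eq_or_eq hJ hJS).resolve_right fun hJ' =>
    hxJ (hJ' ▸ hcov.le (Ideal.mem_span_singleton_self x))

theorem pow_three_eq (hcov : Ideal.span {x} ⋖ (Ideal.span {x}).colon (𝔪 : Set R))
    (h : Ideal.span {x} * 𝔪 ⋖ 𝔪 ^ 2) : 𝔪 ^ 3 = Ideal.span {x} * 𝔪 ^ 2 := by
  have hmono := fun {A B : Ideal R} =>
    Ideal.span_singleton_mul_right_mono (I := A) (J := B) (hx.ne_zero hm)
  obtain ⟨A, hA⟩ := span_singleton_dvd_of_le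
    ((pow_three_le_of_mul_covBy_sq h).trans Ideal.mul_le_left)
  rw [hA, hx.eq_sq_of_le_colon hm hcov h (J := A)]
  · exact hmono.mp (hA ▸ hx.span_singleton_mul_pow_le 2)
  · have hA𝔪 : A * 𝔪 ≤ Ideal.span {x} := by
      refine hmono.mp ?_
      rw [← mul_assoc, ← hA, ← pow_succ, ← pow_two]
      exact hx.pow_four_le hm h
    exact fun a ha => Submodule.mem_colon.mpr fun b hb => hA𝔪 (Ideal.mul_mem_mul ha hb)
  · intro hxA
    refine hx.pow_notMem hm 2 ?_
    rw [← pow_succ', hA, pow_two]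
    exact Ideal.mul_mem_mul (Ideal.mem_span_singleton_self x) hxA

theorem reductionExponent_eq_two_iff
    (hcov : Ideal.span {x} ⋖ (Ideal.span {x}).colon (𝔪 : Set R)) :
    reductionExponent 𝔪 x = 2 ↔ Ideal.span {x} * 𝔪 ⋖ 𝔪 ^ 2 := by
  have hexp : reductionExponent 𝔪 x = 2 ↔
      𝔪 ^ 3 = Ideal.span {x} * 𝔪 ^ 2 ∧ ¬ 𝔪 ^ 2 ≤ Ideal.span {x} := by
    have hle_one : reductionExponent 𝔪 x ≤ 1 ↔ 𝔪 ^ 2 = Ideal.span {x} * 𝔪 := by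
      rw [hx.reductionExponent_le_iff, pow_one]
    rw [hx.sq_le_iff hm, ← hle_one, ← hx.reductionExponent_le_iff (n := 2)]
    omega
  rw [hexp]
  exact ⟨fun ⟨h3, h2⟩ => (hx.mul_covBy_sq_iff hm hcov).mpr ⟨h3.trans_le Ideal.mul_le_left, h2⟩,
    fun h => ⟨hx.pow_three_eq hm hcov h, ((hx.mul_covBy_sq_iff hm hcov).mp h).2⟩⟩

end IsMinimalReduction

end AlmostMinimalMultiplicity

section Conductor

theorem span_singleton_pow_colon_pow_le {R : Type*} [CommRing R] [IsDomain R] {I : Ideal R} {x : R}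
    (hxI : x ∈ I) (hx : x ≠ 0) (n k : ℕ) :
    (Ideal.span {x ^ (n + k)}).colon (↑(I ^ (n + k)) : Set R) ≤
      (Ideal.span {x ^ n}).colon (↑(I ^ n) : Set R) := by
  intro c hc
  refine Submodule.mem_colon.mpr fun a ha => ?_
  have hdvd := Ideal.mem_span_singleton.mp <| Submodule.mem_colon.mp hc (a * x ^ k) <|
    (pow_add I n k).symm ▸ Ideal.mul_mem_mul ha (Ideal.pow_mem_pow hxI k)
  rw [smul_eq_mul, ← mul_assoc, pow_add] at hdvd
  exact Ideal.mem_span_singleton.mpr ((mul_dvd_mul_iff_right (pow_ne_zero k hx)).mp hdvd)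

theorem coeSubmodule_pow {R : Type*} [CommRing R] (S : Type*) [CommRing S] [Algebra R S]
    (I : Ideal R) (n : ℕ) :
    IsLocalization.coeSubmodule S (I ^ n) = IsLocalization.coeSubmodule S I ^ n := by
  induction n with
  | zero => rw [pow_zero, pow_zero, Ideal.one_eq_top, IsLocalization.coeSubmodule_top]
  | succ n ih => rw [pow_succ, IsLocalization.coeSubmodule_mul, ih, ← pow_succ]

variable {R : Type*} [CommRing R] (K : Type*) [Field K] [Algebra R K] [FaithfulSMul R K]
  {I : Ideal R} {x : R} {N : ℕ}

theorem mem_blowup_iff_of_pow_succ_eq (hx : x ≠ 0) (hxI : x ∈ I)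
    (hN : I ^ (N + 1) = Ideal.span {x} * I ^ N) {y : K} :
    y ∈ blowup K I ↔ ∃ a ∈ I ^ N, algebraMap R K a = y * algebraMap R K x ^ N := by
  have hxK (k : ℕ) : algebraMap R K x ^ k ≠ 0 := pow_ne_zero k (by simpa using hx)
  have hpow (k : ℕ) : I ^ (N + k) = Ideal.span {x ^ k} * I ^ N := by
    rw [pow_add_eq_of_eq hN, Ideal.span_singleton_pow]
  simp only [mem_blowup, ← coeSubmodule_pow]
  constructor
  · rintro ⟨n, hn⟩
    obtain ⟨b, hb, hby⟩ := hn _ ⟨x ^ n, Ideal.pow_mem_pow hxI n, rfl⟩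
    have hmem : b * x ^ N ∈ I ^ (N + n) := by
      rw [add_comm, pow_add]
      exact Ideal.mul_mem_mul hb (Ideal.pow_mem_pow hxI N)
    rw [hpow] at hmem
    obtain ⟨a, ha, hab⟩ := Ideal.mem_span_singleton_mul.mp hmem
    refine ⟨a, ha, mul_left_cancel₀ (hxK n) ?_⟩
    have hab' := congrArg (algebraMap R K) hab
    simp only [Algebra.linearMap_apply, map_mul, map_pow] at hab' hby
    linear_combination hab' + algebraMap R K x ^ N * hby
  · rintro ⟨a, ha, hay⟩
    refine ⟨N, ?_⟩
    rintro _ ⟨b, hb, rfl⟩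
    have hmem : a * b ∈ I ^ (N + N) := pow_add I N N ▸ Ideal.mul_mem_mul ha hb
    rw [hpow] at hmem
    obtain ⟨c, hc, hab⟩ := Ideal.mem_span_singleton_mul.mp hmem
    refine ⟨c, hc, mul_left_cancel₀ (hxK N) ?_⟩
    have hab' := congrArg (algebraMap R K) hab
    simp only [Algebra.linearMap_apply, map_mul, map_pow] at hab' ⊢
    linear_combination hab' + algebraMap R K b * hay

theorem one_div_blowup_eq (hx : x ≠ 0) (hxI : x ∈ I)
    (hN : I ^ (N + 1) = Ideal.span {x} * I ^ N) :
    (1 : Submodule R K) / blowup K I =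
      IsLocalization.coeSubmodule K ((Ideal.span {x ^ N}).colon (↑(I ^ N) : Set R)) := by
  have hinj := FaithfulSMul.algebraMap_injective R K
  have hxK : algebraMap R K x ^ N ≠ 0 := pow_ne_zero N (by simpa using hx)
  ext z
  simp only [Submodule.mem_div_iff_forall_mul_mem, Submodule.mem_one,
    IsLocalization.mem_coeSubmodule, mem_blowup_iff_of_pow_succ_eq K hx hxI hN,
    Submodule.mem_colon, smul_eq_mul, Ideal.mem_span_singleton']
  constructor
  · intro hz
    obtain ⟨c, hc⟩ := hz 1 ⟨x ^ N, Ideal.pow_mem_pow hxI N, by rw [map_pow, one_mul]⟩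
    rw [mul_one] at hc
    refine ⟨c, fun a ha => ?_, hc⟩
    obtain ⟨r, hr⟩ := hz (algebraMap R K a / algebraMap R K x ^ N)
      ⟨a, ha, (div_mul_cancel₀ _ hxK).symm⟩
    refine ⟨r, hinj ?_⟩
    rw [map_mul, map_mul, map_pow, hr, hc, mul_assoc, div_mul_cancel₀ _ hxK]
  · rintro ⟨c, hc, rfl⟩ y ⟨a, ha, hay⟩
    obtain ⟨r, hr⟩ := hc a ha
    refine ⟨r, mul_right_cancel₀ hxK ?_⟩
    rw [mul_assoc, ← hay, ← map_pow, ← map_mul, ← map_mul, hr]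

end Conductor

section ConductorSq

variable {R : Type*} [CommRing R] [IsDomain R] [IsLocalRing R] [IsNoetherianRing R]
  (K : Type*) [Field K] [Algebra R K] [IsFractionRing R K] {x : R}

local notation "𝔪" => maximalIdeal R

namespace IsMinimalReduction

theorem one_div_blowup_eq_sq_iff (hx : IsMinimalReduction 𝔪 x) (hm : 𝔪 ≠ ⊥)
    (hcov : Ideal.span {x} ⋖ (Ideal.span {x}).colon (𝔪 : Set R)) :
    (1 : Submodule R K) / blowup K 𝔪 = IsLocalization.coeSubmodule K 𝔪 ^ 2 ↔
      Ideal.span {x} * 𝔪 ⋖ 𝔪 ^ 2 := by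
  have hx0 := hx.ne_zero hm
  have hcond {n : ℕ} (hn : 𝔪 ^ (n + 1) = Ideal.span {x} * 𝔪 ^ n) :
      (1 : Submodule R K) / blowup K 𝔪 = IsLocalization.coeSubmodule K 𝔪 ^ 2 ↔
        (Ideal.span {x ^ n}).colon (↑(𝔪 ^ n) : Set R) = 𝔪 ^ 2 := by
    rw [one_div_blowup_eq K hx0 hx.1 hn, ← coeSubmodule_pow,
      (IsFractionRing.coeSubmodule_injective R K).eq_iff]
  have hanti (n : ℕ) : (Ideal.span {x ^ (1 + n)}).colon (↑(𝔪 ^ (1 + n)) : Set R) ≤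
      (Ideal.span {x}).colon (𝔪 : Set R) := by
    simpa only [pow_one] using span_singleton_pow_colon_pow_le hx.1 hx0 1 n
  refine ⟨fun h => (hx.mul_covBy_sq_iff hm hcov).mpr ⟨?_, fun h2 => ?_⟩, fun h => ?_⟩
  · obtain ⟨N, hN⟩ := hx.2
    have hle := hanti N
    rw [(hcond (hN (1 + N) (Nat.le_add_left N 1))).mp h] at hle
    rw [pow_succ]
    exact Ideal.mul_le.mpr fun a ha b hb => Submodule.mem_colon.mp (hle ha) b hb
  · have hS := (hcond (n := 1) (by rwa [pow_one, ← hx.sq_le_iff hm])).mp h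
    refine hx.pow_notMem hm 1 ?_
    rw [pow_one, pow_one, ← pow_two, ← hS, pow_one, pow_one]
    exact Ideal.le_colon (Ideal.mem_span_singleton_self x)
  · refine (hcond (hx.pow_three_eq hm hcov h)).mpr
      (hx.eq_sq_of_le_colon hm hcov h (fun a ha => ?_) (hanti 1) fun hxS => ?_)
    · refine Submodule.mem_colon.mpr fun b hb => ?_
      rw [← Ideal.span_singleton_pow]
      exact hx.pow_four_le hm h (pow_add 𝔪 2 2 ▸ Ideal.mul_mem_mul ha hb)
    · refine ((hx.mul_covBy_sq_iff hm hcov).mp h).2 fun a ha => ?_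
      have hdvd := Ideal.mem_span_singleton.mp (Submodule.mem_colon.mp hxS a ha)
      rw [smul_eq_mul, pow_two] at hdvd
      exact Ideal.mem_span_singleton.mpr ((mul_dvd_mul_iff_left hx0).mp hdvd)

end IsMinimalReduction

end ConductorSq

end BlowUp

theorem corollary6p10_general {R : Type*} [CommRing R] [IsDomain R] [IsLocalRing R]
    [IsNoetherianRing R] (hdim : ringKrullDim R = 1) (K : Type*) [Field K] [Algebra R K]
    [IsFractionRing R K] (hGor : BlowUp.IsGorensteinLocal R) {x : R}
    (hx : BlowUp.IsMinimalReduction (IsLocalRing.maximalIdeal R) x) :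
    List.TFAE [
      BlowUp.multiplicity (IsLocalRing.maximalIdeal R) = (BlowUp.embeddingDim R : ℤ) + 1,
      BlowUp.reductionExponent (IsLocalRing.maximalIdeal R) x = 2,
      (1 : Submodule R K) / BlowUp.blowup K (IsLocalRing.maximalIdeal R) =
        IsLocalization.coeSubmodule K (IsLocalRing.maximalIdeal R) ^ 2] := by
  have : Ring.KrullDimLE 1 R := (Order.krullDimLE_iff 1 _).mpr hdim.le
  have hm : IsLocalRing.maximalIdeal R ≠ ⊥ := fun h =>
    one_ne_zero (hdim.symm.trans
      (ringKrullDim_eq_zero_of_isField (IsLocalRing.isField_iff_maximalIdeal_eq.mpr h)))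
  have hx0 := hx.ne_zero hm
  have hcov := hGor.covBy_colon (IsSMulRegular.of_ne_zero hx0) hx.1
    (BlowUp.isFiniteLength_quotient (Ideal.span_singleton_eq_bot.not.mpr hx0))
  have h1 := hx.multiplicity_eq_embeddingDim_add_one_iff hm
  have h2 := hx.reductionExponent_eq_two_iff hm hcov
  have h3 := hx.one_div_blowup_eq_sq_iff K hm hcov
  tfae_have 1 ↔ 2 := h1.trans h2.symm
  tfae_have 2 ↔ 3 := h2.trans h3.symm
  tfae_finish

theorem corollary6p10 {R : Type*} [CommRing R] [IsDomain R] [IsLocalRing R] [IsNoetherianRing R]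
    (hdim : ringKrullDim R = 1)
    [Infinite (IsLocalRing.ResidueField R)]
    (K : Type*) [Field K] [Algebra R K] [IsFractionRing R K]
    [Module.Finite R (integralClosure R K)]
    [IsDiscreteValuationRing (integralClosure R K)]
    (hrat : BlowUp.IsResiduallyRational R K)
    (hGor : BlowUp.IsGorensteinLocal R) :
    (∃ x : R, BlowUp.IsMinimalReduction (IsLocalRing.maximalIdeal R) x) ∧
    ∀ x : R, BlowUp.IsMinimalReduction (IsLocalRing.maximalIdeal R) x →
      List.TFAE [
        BlowUp.multiplicity (IsLocalRing.maximalIdeal R) = (BlowUp.embeddingDim R : ℤ) + 1,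
        BlowUp.reductionExponent (IsLocalRing.maximalIdeal R) x = 2,
        (1 : Submodule R K) / BlowUp.blowup K (IsLocalRing.maximalIdeal R) =
          IsLocalization.coeSubmodule K (IsLocalRing.maximalIdeal R) ^ 2] := by
  have : IsNoetherian R (integralClosure R K) := isNoetherian_of_isNoetherianRing_of_finite R _
  exact ⟨BlowUp.exists_isMinimalReduction (integralClosure R K) _,
    fun _ hx => corollary6p10_general hdim K hGor hx⟩
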